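/- Let $\mathbb{D}$ be the open unit disk, $\mathbb{T}$ the unit circle, $m$ normalized Lebesgue measure on $\mathbb{T}$, and let $H^\infty$ be the space of bounded analytic functions on $\mathbb{D}$, identified through boundary values with a subspace of $L^\infty(m)=(L^1(m))^*$ (so that $h(z)=\int_{\mathbb{T}}P_z h\,dm$ for $z\in\mathbb{D}$, where $P_z(w)=\frac{1-|z|^2}{|w-z|^2}$ is the Poisson kernel) and equipped with the weak* topology $\sigma(L^\infty,L^1)$. For a weak*-closed subspace $\mathcal{E}$ of $H^\infty$ let $\mathcal{Q}_{\mathcal{E}}=L^1(m)/{}^{\perp}\mathcal{E}$ be its predual, with the quotient norm and the pairing $\langle [f],h\rangle=\int_{\mathbb{T}} fh\,dm$. A sequence $(x_n)_{n\in\mathbb{N}}$ in a Banach space $X$ is an $\ell^1$-basis of $X$ if it is a Schauder basis of $X$ and there is an invertible bounded linear operator $A:\ell^1\to X$ with $A\epsilon_n=x_n$ for all $n$, where $(\epsilon_n)$ is the canonical basis of $\ell^1$. A sequence $(b_n)$ in $\mathbb{D}$ is interpolating if $h\mapsto(h(b_n))_n$ maps $H^\infty$ onto $\ell^\infty$. **Theorem.**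 Let $\mathcal{E}$ be a weak*-closed subspace of $H^\infty$ and let $\mathbb{D}\subset\Omega\subset\overline{\mathbb{D}}$ be such that every $h\in\mathcal{E}$ extends continuously to $\Omega$ (the extension is again denoted by $h$). Suppose that for every $z\in\Omega$ the evaluation $h\mapsto h(z)$ on $\mathcal{E}$ is given by an element $E_z$ of $\mathcal{Q}_{\mathcal{E}}$, that is, $\langle E_z,h\rangle=h(z)$ for all $h\in\mathcal{E}$, and that the map $\Omega\ni z\mapsto E_z\in\mathcal{Q}_{\mathcal{E}}$ is norm-continuous. Suppose furthermore that $(E_{a_n})_{n\in\mathbb{N}}$ is an $\ell^1$-basis of $\mathcal{Q}_{\mathcal{E}}$ for some points $a_n\in\mathbb{T}\cap\Omega$. Then there exist numbers $\tau_n>0$ such that (i) the closed disks $\{z\in\mathbb{C}:|z-a_n|\le\tau_n\}$, $n\in\mathbb{N}$, are pairwise disjoint, and (ii) for every sequence $(b_n)_{n\in\mathbb{N}}$ with $b_n\in\mathbb{D}$ and $|b_n-a_n|<\tau_n$ for all $n$, the sequence $(E_{b_n})_n$ is an $\ell^1$-basis of $\mathcal{Q}_{\mathcal{E}}$, and $(b_n)_n$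 is an interpolating sequence. -/

import Mathlib

open MeasureTheory Filter Topology Metric
open scoped ENNReal Real

noncomputable section

namespace HardySpace

instance factTwoPiPos : Fact (0 < 2 * π) := ⟨Real.two_pi_pos⟩

/-- The unit circle, parametrized by the angle: `t` stands for the point `exp (i t)`. -/
abbrev Torus : Type := AddCircle (2 * π)

/-- The normalized Lebesgue measure `m` of the circle. -/
abbrev m : Measure Torus := AddCircle.haarAddCircle

/-- `L¹(m)`. -/
abbrev LOne : Type := Lp ℂ 1 m

/-- `L^∞(m)`. -/
abbrev LInf : Type := Lp ℂ ∞ m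

/-- The duality `⟨f, h⟩ = ∫ f h dm` between `L¹(m)` and `L^∞(m)`. -/
def pairing : LOne →L[ℂ] LInf →L[ℂ] ℂ :=
  (ContinuousLinearMap.mul ℂ ℂ).lpPairing m 1 ∞

theorem pairing_apply (f : LOne) (h : LInf) : pairing f h = ∫ t, f t * h t ∂m := by
  simp [pairing, ContinuousLinearMap.lpPairing_eq_integral]

/-- The same duality, as an algebraic bilinear form on `L^∞(m) × L¹(m)`. -/
def pairingForm : LInf →ₗ[ℂ] LOne →ₗ[ℂ] ℂ where
  toFun h := (pairing.flip h).toLinearMap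
  map_add' h k := by ext f; simp
  map_smul' c h := by ext f; simp

/-- The weak* topology `σ(L^∞, L¹)`: the coarsest topology on `L^∞(m)` for which
`h ↦ ⟨f, h⟩` is continuous for each `f ∈ L¹(m)`. -/
abbrev weakStarTopology : TopologicalSpace LInf :=
  inferInstanceAs (TopologicalSpace (WeakBilin pairingForm))

/-- `E` is weak*-closed. -/
def IsWeakStarClosed (E : Submodule ℂ LInf) : Prop :=
  IsClosed[weakStarTopology] (E : Set LInf)

/-- `F` is bounded and analytic in the open unit disk. -/
def IsBoundedAnalytic (F : ℂ → ℂ) : Prop :=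
  DifferentiableOn ℂ F (ball 0 1) ∧ ∃ M : ℝ, ∀ z ∈ ball (0 : ℂ) 1, ‖F z‖ ≤ M

/-- The function in the disk with boundary function `h`, that is, the Poisson integral
`z ↦ ∫ P_z h dm`, with `P_z (w) = (1 - |z|²) / |w - z|²` for `|w| = 1`. -/
def discFun (h : LInf) (z : ℂ) : ℂ :=
  ∫ t : Torus, (poissonKernel 0 z (AddCircle.toCircle t : ℂ) : ℂ) * h t ∂m

theorem integrable_poisson_mul (h : LInf) {z : ℂ} (hz : z ∈ ball (0 : ℂ) 1) :
    Integrable (fun t : Torus => (poissonKernel 0 z (AddCircle.toCircle t : ℂ) : ℂ) * h t) m := by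
  have hh : Integrable (fun t => h t) m := (Lp.memLp h).integrable le_top
  have hc : Continuous
      (fun t : Torus => (poissonKernel 0 z (AddCircle.toCircle t : ℂ) : ℂ)) := by
    unfold poissonKernel
    refine Complex.continuous_ofReal.comp (Continuous.div ?_ ?_ ?_)
    · have := AddCircle.continuous_toCircle (T := 2 * π)
      fun_prop
    · have := AddCircle.continuous_toCircle (T := 2 * π)
      fun_prop
    · intro t ht
      have h0 : (AddCircle.toCircle t : ℂ) = z := by
        have h2 := pow_eq_zero_iff (two_ne_zero) |>.mp ht
        simpa [sub_eq_zero] using h2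
      rw [mem_ball_zero_iff, ← h0] at hz
      rw [Circle.norm_coe] at hz
      exact lt_irrefl _ hz
  obtain ⟨C, hC⟩ := isCompact_univ.exists_bound_of_continuousOn hc.continuousOn
  exact hh.bdd_mul hc.aestronglyMeasurable
    (Eventually.of_forall fun t => hC t (Set.mem_univ t))

theorem discFun_add (h k : LInf) {z : ℂ} (hz : z ∈ ball (0 : ℂ) 1) :
    discFun (h + k) z = discFun h z + discFun k z := by
  unfold discFun
  rw [← integral_add (integrable_poisson_mul h hz) (integrable_poisson_mul k hz)]
  refine integral_congr_ae ?_
  filter_upwards [Lp.coeFn_add h k] with t ht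
  rw [ht, Pi.add_apply, mul_add]

theorem discFun_smul (c : ℂ) (h : LInf) (z : ℂ) : discFun (c • h) z = c * discFun h z := by
  unfold discFun
  rw [← integral_const_mul]
  refine integral_congr_ae ?_
  filter_upwards [Lp.coeFn_smul c h] with t ht
  rw [ht, Pi.smul_apply, smul_eq_mul]
  ring

/-- `H^∞`, as a subspace of `L^∞(m)`: the boundary functions of the bounded analytic functions
of the open unit disk. The element `h` is identified with the analytic function `discFun h`. -/
def HInf : Submodule ℂ LInf where
  carrier := {h | IsBoundedAnalytic (discFun h)}
  zero_mem' := by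
    have h0 : discFun 0 = fun _ => 0 := by
      funext z
      simpa using discFun_smul 0 0 z
    show IsBoundedAnalytic (discFun 0)
    rw [h0]
    exact ⟨differentiableOn_const 0, 0, by simp⟩
  add_mem' := by
    rintro h k ⟨hd, M, hM⟩ ⟨kd, N, hN⟩
    refine ⟨(hd.add kd).congr fun z hz => discFun_add h k hz, M + N, fun z hz => ?_⟩
    rw [discFun_add h k hz]
    exact (norm_add_le _ _).trans (add_le_add (hM z hz) (hN z hz))
  smul_mem' := by
    rintro c h ⟨hd, M, hM⟩
    refine ⟨(hd.const_mul c).congr fun z _ => discFun_smul c h z, ‖c‖ * M, fun z hz => ?_⟩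
    rw [discFun_smul, norm_mul]
    exact mul_le_mul_of_nonneg_left (hM z hz) (norm_nonneg c)

/-- The preannihilator of `E` in `L¹(m)`. -/
def preannihilator (E : Submodule ℂ LInf) : Submodule ℂ LOne where
  carrier := {f | ∀ h ∈ E, pairing f h = 0}
  zero_mem' := by simp
  add_mem' := by
    intro f g hf hg h hh
    simp [hf h hh, hg h hh]
  smul_mem' := by
    intro c f hf h hh
    simp [hf h hh]

instance isClosed_preannihilator (E : Submodule ℂ LInf) :
    IsClosed (preannihilator E : Set LOne) := by
  have : (preannihilator E : Set LOne) = ⋂ h ∈ E, {f | pairing.flip h f = 0} := by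
    ext f
    simp [preannihilator]
  rw [this]
  exact isClosed_biInter fun h _ => isClosed_eq (pairing.flip h).continuous continuous_const

/-- The predual of a weak*-closed subspace `E` of `L^∞(m)`: the quotient of `L¹(m)` by the
preannihilator of `E`, with the quotient norm. -/
abbrev Predual (E : Submodule ℂ LInf) : Type := LOne ⧸ preannihilator E

/-- The duality `⟨[f], h⟩ = ∫ f h dm` between the predual of `E` and `E`. -/
def predualPairing (E : Submodule ℂ LInf) (q : Predual E) (h : E) : ℂ :=
  (preannihilator E).liftQ (pairingForm h.1) (fun _ hf => hf h.1 h.2) q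

/-- `F`, a function in the open unit disk, extends continuously to `Ω`. -/
def ExtendsContinuously (F : ℂ → ℂ) (Ω : Set ℂ) : Prop :=
  ∃ G : ℂ → ℂ, ContinuousOn G Ω ∧ Set.EqOn G F (ball 0 1)

/-- The value at `z` of the continuous extension of `discFun h`, namely the limit of
`discFun h w` as `w` tends to `z` within the open unit disk. -/
def extendedValue (h : LInf) (z : ℂ) : ℂ :=
  extendFrom (ball (0 : ℂ) 1) (discFun h) z

/-- The element `q` of the predual of `E` is the evaluation `E_z` at `z`, that is,
`⟨q, h⟩ = h(z)` for all `h ∈ E`. -/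
def IsEvaluation (E : Submodule ℂ LInf) (z : ℂ) (q : Predual E) : Prop :=
  ∀ h : E, predualPairing E q h = extendedValue h.1 z

/-- `x` is an `ℓ¹`-basis of `X`: a Schauder basis that is equivalent to the canonical basis of
`ℓ¹`, by an invertible bounded linear operator from `ℓ¹` to `X`. -/
def IsEllOneBasis {X : Type*} [NormedAddCommGroup X] [NormedSpace ℂ X] (x : ℕ → X) : Prop :=
  (∃ s : SchauderBasis ℂ X, s.basis = x) ∧
    ∃ A : lp (fun _ : ℕ => ℂ) 1 ≃L[ℂ] X, ∀ n, A (lp.single 1 n (1 : ℂ)) = x n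

/-- `b` is an interpolating sequence: a sequence in the open unit disk such that `F ↦ (F (b n))`
maps the space of bounded analytic functions of the disk onto `ℓ^∞`. -/
def IsInterpolating (b : ℕ → ℂ) : Prop :=
  (∀ n, b n ∈ ball (0 : ℂ) 1) ∧
    ∀ c : lp (fun _ : ℕ => ℂ) ∞, ∃ F : ℂ → ℂ, IsBoundedAnalytic F ∧ ∀ n, F (b n) = c n

end HardySpace

end

namespace HardySpace

/-! ### Bases equivalent to the canonical basis of `ℓ¹`. -/

section EllOne

variable {X : Type*} [NormedAddCommGroup X] [NormedSpace ℂ X]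

/-- A bounded sequence in a Banach space is the image of the canonical basis under a bounded
operator on `ℓ¹`. -/
theorem exists_ellOne_map [CompleteSpace X] (x : ℕ → X) {C : ℝ} (hC : 0 ≤ C)
    (hx : ∀ n, ‖x n‖ ≤ C) :
    ∃ B : lp (fun _ : ℕ => ℂ) 1 →L[ℂ] X,
      (∀ n, B (lp.single 1 n (1 : ℂ)) = x n) ∧ ‖B‖ ≤ C := by
  have hs (f : lp (fun _ : ℕ => ℂ) 1) : HasSum (fun n => ‖f n‖) ‖f‖ := by
    simpa using lp.hasSum_norm (by simp) f
  have hb (f : lp (fun _ : ℕ => ℂ) 1) (n : ℕ) : ‖f n • x n‖ ≤ C * ‖f n‖ := by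
    rw [norm_smul, mul_comm]
    exact mul_le_mul_of_nonneg_right (hx n) (norm_nonneg _)
  have hsum (f : lp (fun _ : ℕ => ℂ) 1) : Summable fun n => f n • x n :=
    .of_norm_bounded ((hs f).summable.mul_left C) (hb f)
  let L : lp (fun _ : ℕ => ℂ) 1 →ₗ[ℂ] X :=
    { toFun := fun f => ∑' n, f n • x n
      map_add' := fun f g => by
        rw [← (hsum f).tsum_add (hsum g)]
        simp [add_smul]
      map_smul' := fun c f => by
        rw [RingHom.id_apply, ← (hsum f).tsum_const_smul c]
        simp [mul_smul] }
  have hL (f : lp (fun _ : ℕ => ℂ) 1) : ‖L f‖ ≤ C * ‖f‖ :=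
    tsum_of_norm_bounded ((hs f).mul_left C) (hb f)
  refine ⟨L.mkContinuous C hL, fun n => ?_, L.mkContinuous_norm_le hC hL⟩
  show ∑' k, (lp.single 1 n (1 : ℂ) : lp (fun _ : ℕ => ℂ) 1) k • x k = x n
  rw [tsum_eq_single n fun k hk => by rw [lp.single_apply_ne _ _ _ hk, zero_smul],
    lp.single_apply_self, one_smul]

theorem isEllOneBasis_of_equiv {x : ℕ → X} (A : lp (fun _ : ℕ => ℂ) 1 ≃L[ℂ] X)
    (hA : ∀ n, A (lp.single 1 n (1 : ℂ)) = x n) : IsEllOneBasis x := by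
  refine ⟨⟨⟨x, fun n => (lp.evalCLM ℂ (fun _ : ℕ => ℂ) 1 n).comp A.symm.toContinuousLinearMap,
    fun i j => ?_, fun y => ?_⟩, rfl⟩, A, hA⟩
  · rw [← hA j]
    show A.symm (A (lp.single 1 j 1)) i = _
    rw [A.symm_apply_apply, lp.coeFn_single]
    congr!
  · have h := (lp.hasSum_single (by simp) (A.symm y)).mapL A.toContinuousLinearMap
    simp only [ContinuousLinearEquiv.coe_coe, ContinuousLinearEquiv.apply_symm_apply] at h
    have h' : HasSum (fun n => A.symm y n • x n) y := by
      convert h using 2 with n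
      rw [← hA n, ← map_smul, ← lp.single_smul, smul_eq_mul, mul_one]
    -- The expansion converges unconditionally; a Schauder basis asks only for ordered partial sums.
    exact Tendsto.mono_left h' SummationFilter.le_atTop

/-- An `ℓ¹`-basis is stable under uniformly small perturbations. -/
theorem IsEllOneBasis.exists_perturbation [CompleteSpace X] {x : ℕ → X} (hx : IsEllOneBasis x) :
    ∃ ε > 0, ∀ y : ℕ → X, (∀ n, ‖y n - x n‖ ≤ ε) → IsEllOneBasis y := by
  obtain ⟨-, A, hA⟩ := hx
  set K : ℝ := ‖A.symm.toContinuousLinearMap‖ with hK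
  have hK0 : 0 ≤ K := norm_nonneg _
  -- With `D` sending the canonical basis to `y n - x n` and `T = A⁻¹ D`, this bound gives `‖T‖ ≤ K
  -- / (K + 1) < 1`. So `1 + T` is invertible, and `A (1 + T)` sends the canonical basis to `y`.
  refine ⟨(K + 1)⁻¹, by positivity, fun y hy => ?_⟩
  obtain ⟨D, hD, hDn⟩ := exists_ellOne_map (fun n => y n - x n) (by positivity) hy
  set T := A.symm.toContinuousLinearMap.comp D
  have hT : ‖-T‖ < 1 := by
    rw [norm_neg]
    calc ‖T‖ ≤ K * ‖D‖ := ContinuousLinearMap.opNorm_comp_le _ _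
      _ ≤ K * (K + 1)⁻¹ := by gcongr
      _ < 1 := by rw [← div_eq_mul_inv, div_lt_one (by positivity)]; linarith
  refine isEllOneBasis_of_equiv
    ((ContinuousLinearEquiv.unitsEquiv ℂ _ (Units.oneSub (-T) hT)).trans A) fun n => ?_
  have h : (ContinuousLinearEquiv.unitsEquiv ℂ _ (Units.oneSub (-T) hT))
      (lp.single 1 n (1 : ℂ)) = lp.single 1 n (1 : ℂ) + T (lp.single 1 n (1 : ℂ)) := by
    rw [ContinuousLinearEquiv.unitsEquiv_apply]
    simp
  rw [ContinuousLinearEquiv.trans_apply, h, map_add, hA]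
  simp [T, hD]

/-- Pulled back by `A⁻¹`, the difference has `i`-th coordinate `1`, hence norm at least `1`. -/
theorem IsEllOneBasis.exists_separation {x : ℕ → X} (hx : IsEllOneBasis x) :
    ∃ δ > 0, ∀ i j, i ≠ j → δ ≤ ‖x i - x j‖ := by
  obtain ⟨-, A, hA⟩ := hx
  set K : ℝ := ‖A.symm.toContinuousLinearMap‖ with hK
  have hK0 : 0 ≤ K := norm_nonneg _
  refine ⟨(K + 1)⁻¹, by positivity, fun i j hij => ?_⟩
  have h1 : 1 ≤ ‖A.symm (x i - x j)‖ := by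
    rw [← hA i, ← hA j, ← map_sub, A.symm_apply_apply]
    refine le_trans ?_ (lp.norm_apply_le_norm one_ne_zero _ i)
    simp [hij]
  have h2 : ‖A.symm (x i - x j)‖ ≤ K * ‖x i - x j‖ :=
    A.symm.toContinuousLinearMap.le_opNorm _
  rw [inv_le_iff_one_le_mul₀ (by positivity)]
  nlinarith [norm_nonneg (x i - x j)]

/-- Bounded functionals take arbitrary bounded values on an `ℓ¹`-basis. -/
theorem IsEllOneBasis.exists_functional {x : ℕ → X} (hx : IsEllOneBasis x)
    (c : lp (fun _ : ℕ => ℂ) ∞) : ∃ φ : X →L[ℂ] ℂ, ∀ n, φ (x n) = c n := by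
  obtain ⟨-, A, hA⟩ := hx
  obtain ⟨B, hB, -⟩ := exists_ellOne_map (fun n => c n) (norm_nonneg c)
    (lp.norm_apply_le_norm ENNReal.top_ne_zero c)
  refine ⟨B.comp A.symm.toContinuousLinearMap, fun n => ?_⟩
  rw [← hA n, ← hB n]
  simp

end EllOne

/-! ### The Poisson kernel as an `L¹`-valued function on the disk. -/

section Poisson

/-- The inclusion of the circle in `ℂ`. -/
noncomputable def circleCoord : C(Torus, ℂ) :=
  ⟨fun t => (AddCircle.toCircle t : ℂ), by
    have := AddCircle.continuous_toCircle (T := 2 * π)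
    fun_prop⟩

/-- The denominator of the Poisson kernel. -/
noncomputable def poissonDenom (z : ℂ) : C(Torus, ℂ) :=
  (circleCoord - algebraMap ℂ _ z) * (star circleCoord - algebraMap ℂ _ (star z))

/-- The Poisson kernel at a point of the disk, as a continuous function on the circle. -/
noncomputable def poissonCont (z : ℂ) : C(Torus, ℂ) :=
  (1 - z * star z) • Ring.inverse (poissonDenom z)

/-- The Poisson kernel at a point of the disk, as an element of `L¹(m)`. -/
noncomputable def poissonLp (z : ℂ) : LOne :=
  ContinuousMap.toLp 1 m ℂ (poissonCont z)

theorem poissonDenom_apply (z : ℂ) (t : Torus) :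
    poissonDenom z t = ((‖(AddCircle.toCircle t : ℂ) - z‖ ^ 2 : ℝ) : ℂ) := by
  rw [← Complex.normSq_eq_norm_sq, ← Complex.mul_conj, map_sub]
  rfl

theorem isUnit_poissonDenom {z : ℂ} (hz : z ∈ ball (0 : ℂ) 1) : IsUnit (poissonDenom z) := by
  rw [ContinuousMap.isUnit_iff_forall_ne_zero]
  intro t ht
  rw [poissonDenom_apply, Complex.ofReal_eq_zero, sq_eq_zero_iff, norm_eq_zero, sub_eq_zero] at ht
  rw [mem_ball_zero_iff, ← ht, Circle.norm_coe] at hz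
  exact lt_irrefl _ hz

theorem poissonCont_apply {z : ℂ} (hz : z ∈ ball (0 : ℂ) 1) (t : Torus) :
    poissonCont z t = (poissonKernel 0 z (AddCircle.toCircle t : ℂ) : ℂ) := by
  have h1 : poissonDenom z t * Ring.inverse (poissonDenom z) t = 1 := by
    rw [← ContinuousMap.mul_apply, Ring.mul_inverse_cancel _ (isUnit_poissonDenom hz),
      ContinuousMap.one_apply]
  have h2 : 1 - z * star z = ((1 - ‖z‖ ^ 2 : ℝ) : ℂ) := by
    rw [← Complex.normSq_eq_norm_sq, Complex.ofReal_sub, ← Complex.mul_conj]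
    simp
  rw [poissonCont, ContinuousMap.smul_apply, eq_inv_of_mul_eq_one_right h1, poissonDenom_apply,
    h2, poissonKernel, smul_eq_mul, sub_zero, sub_zero, Circle.norm_coe, one_pow,
    Complex.ofReal_div, div_eq_mul_inv]

theorem pairing_poissonLp (h : LInf) {z : ℂ} (hz : z ∈ ball (0 : ℂ) 1) :
    pairing (poissonLp z) h = discFun h z := by
  rw [pairing_apply, discFun]
  refine integral_congr_ae ?_
  filter_upwards [ContinuousMap.coeFn_toLp (p := 1) (𝕜 := ℂ) m (poissonCont z)] with t ht
  rw [poissonLp, ht, poissonCont_apply hz]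

/-- Inversion in the Banach algebra `C(Torus, ℂ)` is differentiable at units. Only real
differentiability holds, because of the conjugate of `z`. -/
theorem differentiableAt_poissonLp {z : ℂ} (hz : z ∈ ball (0 : ℂ) 1) :
    DifferentiableAt ℝ poissonLp z := by
  have hstar : DifferentiableAt ℝ (fun w : ℂ => star w) z :=
    Complex.conjCLE.differentiableAt
  have halg (w : ℂ) : DifferentiableAt ℝ (fun w : ℂ => algebraMap ℂ C(Torus, ℂ) w) w :=
    ((algebraMapCLM ℂ C(Torus, ℂ)).restrictScalars ℝ).differentiableAt
  have hden : DifferentiableAt ℝ poissonDenom z :=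
    ((differentiableAt_const _).sub (halg z)).mul
      ((differentiableAt_const _).sub ((halg (star z)).comp z hstar))
  have hinv : DifferentiableAt ℝ (fun w => Ring.inverse (poissonDenom w)) z :=
    (differentiableAt_inverse (𝕜 := ℝ) (isUnit_poissonDenom hz)).comp z hden
  have hc : DifferentiableAt ℝ poissonCont z :=
    ((differentiableAt_const _).sub (differentiableAt_id.mul hstar)).smul hinv
  exact ((ContinuousMap.toLp 1 m ℂ).restrictScalars ℝ).differentiableAt.comp z hc

theorem integral_poissonKernel {z : ℂ} (hz : z ∈ ball (0 : ℂ) 1) :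
    ∫ t : Torus, poissonKernel 0 z (AddCircle.toCircle t : ℂ) ∂m = 1 := by
  have h := (diffContOnCl_const (𝕜 := ℂ) (c := (1 : ℂ))
    (s := ball (0 : ℂ) 1)).circleAverage_poissonKernel_smul hz
  rw [Real.circleAverage_def] at h
  have h2 : ∫ θ in (0 : ℝ)..2 * π, (poissonKernel 0 z • fun _ => (1 : ℂ)) (circleMap 0 1 θ) =
      ((∫ t : Torus, poissonKernel 0 z (AddCircle.toCircle t : ℂ) : ℝ) : ℂ) := by
    refine Eq.trans ?_ integral_ofReal
    rw [← AddCircle.intervalIntegral_preimage (2 * π) 0, zero_add]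
    refine intervalIntegral.integral_congr fun θ _ => ?_
    simp [circleMap, AddCircle.toCircle_apply_mk, Circle.coe_exp]
  rw [h2] at h
  rw [AddCircle.integral_haarAddCircle, smul_eq_mul]
  rw [Complex.real_smul] at h
  exact_mod_cast h

theorem norm_poissonLp {z : ℂ} (hz : z ∈ ball (0 : ℂ) 1) : ‖poissonLp z‖ = 1 := by
  rw [L1.norm_eq_integral_norm, ← integral_poissonKernel hz]
  refine integral_congr_ae ?_
  filter_upwards [ContinuousMap.coeFn_toLp (p := 1) (𝕜 := ℂ) m (poissonCont z)] with t ht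
  rw [poissonLp, ht, poissonCont_apply hz, Complex.norm_real, Real.norm_of_nonneg]
  rw [mem_ball_zero_iff] at hz
  refine div_nonneg ?_ (sq_nonneg _)
  simp only [sub_zero, Circle.norm_coe]
  nlinarith [norm_nonneg z]

end Poisson

/-! ### From functionals on the predual to bounded analytic functions. -/

section Predual

variable {E : Submodule ℂ LInf}

/-- A functional on `L¹(m)` that vanishes on the preannihilator of a subspace of `H^∞` is
bounded and analytic along the Poisson kernels. -/
theorem isBoundedAnalytic_functional_poissonLp (hE : E ≤ HInf) (ψ : LOne →L[ℂ] ℂ)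
    (hψ : ∀ f ∈ preannihilator E, ψ f = 0) : IsBoundedAnalytic fun z => ψ (poissonLp z) := by
  refine ⟨fun z hz => DifferentiableAt.differentiableWithinAt ?_, ‖ψ‖, fun z hz => ?_⟩
  · have hP := (differentiableAt_poissonLp hz).hasFDerivAt
    set D := fderiv ℝ poissonLp z
    have hcomp (χ : LOne →L[ℂ] ℂ) : HasFDerivAt (𝕜 := ℝ) (fun w => χ (poissonLp w))
        ((χ.restrictScalars ℝ).comp D) z :=
      (χ.restrictScalars ℝ).hasFDerivAt.comp z hP
    -- Up to a constant this is the `∂̄`-derivative of `P_z`. Each `h ∈ E` annihilates it by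
    -- Cauchy–Riemann for `discFun h`, so `ψ` does too, which is Cauchy–Riemann for `ψ (P_z)`.
    have hmem : D Complex.I - Complex.I • D 1 ∈ preannihilator E := by
      intro h hh
      have hd : DifferentiableAt ℂ (fun w => pairing.flip h (poissonLp w)) z := by
        refine ((hE hh).1.differentiableAt (isOpen_ball.mem_nhds hz)).congr_of_eventuallyEq ?_
        filter_upwards [isOpen_ball.mem_nhds hz] with w hw
        exact pairing_poissonLp h hw
      have hcr := (differentiableAt_complex_iff_differentiableAt_real.mp hd).2
      rw [(hcomp (pairing.flip h)).fderiv] at hcr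
      have hcr' : pairing (D Complex.I) h = Complex.I * pairing (D 1) h := hcr
      simp [hcr']
    refine differentiableAt_complex_iff_differentiableAt_real.mpr
      ⟨(hcomp ψ).differentiableAt, ?_⟩
    rw [(hcomp ψ).fderiv]
    have h0 := hψ _ hmem
    rw [map_sub, map_smul, sub_eq_zero] at h0
    exact h0
  · simpa [norm_poissonLp hz] using ψ.le_opNorm (poissonLp z)

theorem extendedValue_eq_discFun {h : LInf} (hh : h ∈ HInf) {z : ℂ} (hz : z ∈ ball (0 : ℂ) 1) :
    extendedValue h z = discFun h z :=
  extendFrom_eq (subset_closure hz) (hh.1.continuousOn z hz)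

/-- At a point of the disk, the evaluation is the class of the Poisson kernel. -/
theorem IsEvaluation.eq_mk_poissonLp (hE : E ≤ HInf) {z : ℂ} (hz : z ∈ ball (0 : ℂ) 1)
    {q : Predual E} (hq : IsEvaluation E z q) :
    q = Submodule.Quotient.mk (poissonLp z) := by
  obtain ⟨f, rfl⟩ := Submodule.Quotient.mk_surjective _ q
  rw [Submodule.Quotient.eq]
  intro h hh
  have h1 : pairing f h = extendedValue h z := hq ⟨h, hh⟩
  rw [map_sub, sub_apply, h1, pairing_poissonLp h hz,
    extendedValue_eq_discFun (hE hh) hz, sub_self]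

theorem isInterpolating_of_isEllOneBasis (hE : E ≤ HInf) {b : ℕ → ℂ}
    (hb : ∀ n, b n ∈ ball (0 : ℂ) 1) {q : ℕ → Predual E}
    (hq : ∀ n, IsEvaluation E (b n) (q n)) (hbasis : IsEllOneBasis q) : IsInterpolating b := by
  refine ⟨hb, fun c => ?_⟩
  obtain ⟨φ, hφ⟩ := hbasis.exists_functional c
  let π₀ : LOne →L[ℂ] Predual E := (preannihilator E).mkQL
  refine ⟨fun z => φ.comp π₀ (poissonLp z),
    isBoundedAnalytic_functional_poissonLp hE (φ.comp π₀) fun f hf => ?_, fun n => ?_⟩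
  · have h0 : π₀ f = 0 := (Submodule.Quotient.mk_eq_zero _).mpr hf
    rw [ContinuousLinearMap.comp_apply, h0, map_zero]
  · rw [← hφ n, (hq n).eq_mk_poissonLp hE (hb n)]
    rfl

end Predual

end HardySpace

/-- Radii less than half of the distance to the other points give disjoint closed balls. -/
theorem pairwise_disjoint_closedBall_of_lt_dist {α : Type*} [PseudoMetricSpace α] {a : ℕ → α}
    {τ : ℕ → ℝ} (h : ∀ i j, i ≠ j → 2 * τ i < dist (a i) (a j)) :
    Pairwise fun i j => Disjoint (closedBall (a i) (τ i)) (closedBall (a j) (τ j)) := by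
  intro i j hij
  have h1 := h i j hij
  have h2 := h j i hij.symm
  rw [dist_comm] at h2
  exact closedBall_disjoint_closedBall (by linarith)

theorem mainTheorem5
    (E : Submodule ℂ HardySpace.LInf)
    (hE : E ≤ HardySpace.HInf)
    (hEclosed : HardySpace.IsWeakStarClosed E)
    (Ω : Set ℂ) (hDΩ : ball (0 : ℂ) 1 ⊆ Ω) (hΩD : Ω ⊆ closedBall (0 : ℂ) 1)
    (hext : ∀ h ∈ E, HardySpace.ExtendsContinuously (HardySpace.discFun h) Ω)
    (ev : ℂ → HardySpace.Predual E)
    (hev : ∀ z ∈ Ω, HardySpace.IsEvaluation E z (ev z))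
    (hevcont : ContinuousOn ev Ω)
    (a : ℕ → ℂ) (ha : ∀ n, a n ∈ sphere (0 : ℂ) 1 ∩ Ω)
    (hbasis : HardySpace.IsEllOneBasis (fun n => ev (a n))) :
    ∃ τ : ℕ → ℝ, (∀ n, 0 < τ n) ∧
      Pairwise (fun i j => Disjoint (closedBall (a i) (τ i)) (closedBall (a j) (τ j))) ∧
      ∀ b : ℕ → ℂ, (∀ n, b n ∈ ball (0 : ℂ) 1 ∩ ball (a n) (τ n)) →
        HardySpace.IsEllOneBasis (fun n => ev (b n)) ∧ HardySpace.IsInterpolating b := by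
  obtain ⟨ε, hε, hpert⟩ := hbasis.exists_perturbation
  obtain ⟨δ, hδ, hsep⟩ := hbasis.exists_separation
  have hcont (n : ℕ) : ∃ r > 0, ∀ z ∈ Ω, dist z (a n) < r →
      dist (ev z) (ev (a n)) < min ε δ :=
    Metric.continuousOn_iff.mp hevcont (a n) (ha n).2 _ (lt_min hε hδ)
  choose r hr hrev using hcont
  -- By separation no other `a j` lies within `r n` of `a n`, so any radius below `r n / 2` gives
  -- disjoint closed disks.
  refine ⟨fun n => r n / 3, fun n => by have := hr n; positivity,
    pairwise_disjoint_closedBall_of_lt_dist fun i j hij => ?_, fun b hb => ?_⟩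
  · have hij' : r i ≤ dist (a i) (a j) := by
      by_contra! hlt
      rw [dist_comm] at hlt
      have h := (hrev i (a j) (ha j).2 hlt).trans_le (min_le_right _ _)
      rw [dist_eq_norm] at h
      exact (hsep j i hij.symm).not_gt h
    linarith [hr i]
  · have hbasis' : HardySpace.IsEllOneBasis (fun n => ev (b n)) := by
      refine hpert _ fun n => ?_
      have hn : dist (b n) (a n) < r n := (mem_ball.mp (hb n).2).trans (by linarith [hr n])
      rw [← dist_eq_norm]
      exact ((hrev n (b n) (hDΩ (hb n).1) hn).trans_le (min_le_left _ _)).le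
    exact ⟨hbasis', HardySpace.isInterpolating_of_isEllOneBasis hE (fun n => (hb n).1)
      (fun n => hev _ (hDΩ (hb n).1)) hbasis'⟩
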